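/- A polyomino is a finite, nonempty union $P\subset\mathbb R^2$ of closed unit squares (pixels) with integer vertices that is connected through shared edges (holes are allowed). A solution in $P$ with circular scan range $1$ is a pair $(T,\mathcal S)$, where $T$ is a closed curve in $P$ and $\mathcal S$ is a finite set of scan points on $T$ that covers $P$: for every $q\in P$ there is a $p\in\mathcal S$ such that the segment $qp$ lies in $P$ and its Euclidean length is at most $1$. Let $L(T)\in[0,\infty]$ be the length of $T$ in the $L_1$ metric, and for a scan cost $c\ge 0$ let $t_c(T,\mathcal S)=c\,|\mathcal S|+L(T)$ be the combined cost. A diagonal grid is one of the two sets $\{(a,b)\in\mathbb Z^2: a+b\equiv k \pmod 2\}$ ($k\in\mathbb{Z}$). Theorem. Let $P$ be a polyomino and let $D$ be a diagonal grid. Then there is a solution $(T,\mathcal S)$ in $P$ with scan range $1$ whose set of scan points is $\mathcal S=D\cap P$, such that for every solution $(T^*,\mathcal S^*)$ in $P$ with scan range $1$ (in particular for an optimal one) $$|\mathcal S|\le 4\,|\mathcal S^*|,\qquad L(T)\le 4\,L(T^*)+8,$$ and hence $t_c(T,\mathcal S)\le 4\,t_c(T^*,\mathcal S^*)+8$ for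 every $c\ge 0$. The same holds with a prescribed starting point: for every point $s\in\mathbb Z^2\cap P$ there is a solution $(T,\mathcal S)$ with $\mathcal S=D\cap P$ whose tour starts and ends at $s$ and that satisfies these inequalities for all solutions $(T^*,\mathcal S^*)$ whose tour starts and ends at $s$. -/

import Mathlib

open scoped NNReal ENNReal

/-- The Euclidean plane. -/
abbrev Plane : Type := EuclideanSpace ℝ (Fin 2)

/-- The closed unit square (pixel) with lower left corner `z`. -/
def pixel (z : ℤ × ℤ) : Set Plane :=
  {p | (z.1 : ℝ) ≤ p 0 ∧ p 0 ≤ z.1 + 1 ∧ (z.2 : ℝ) ≤ p 1 ∧ p 1 ≤ z.2 + 1}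

/-- Two pixels are adjacent if they share an edge. -/
def pixelGraph : SimpleGraph (ℤ × ℤ) where
  Adj z w := |z.1 - w.1| + |z.2 - w.2| = 1
  symm := ⟨fun z w h => by rwa [abs_sub_comm w.1, abs_sub_comm w.2]⟩
  loopless := ⟨fun z h => by simp at h⟩

/-- A polyomino: a nonempty finite set of pixels that is connected through shared edges.
Holes are allowed. -/
structure Polyomino where
  cells : Finset (ℤ × ℤ)
  connected : (pixelGraph.induce (cells : Set (ℤ × ℤ))).Connected

/-- The region of the plane occupied by a polyomino. -/
def Polyomino.region (P : Polyomino) : Set Plane := ⋃ z ∈ P.cells, pixel z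

/-- The set `S` of scan points covers `P` with circular scan range `r`: every point of `P` sees,
inside `P`, a scan point at Euclidean distance at most `r`. -/
def Covers (P : Set Plane) (r : ℝ) (S : Set Plane) : Prop :=
  ∀ q ∈ P, ∃ p ∈ S, segment ℝ q p ⊆ P ∧ dist q p ≤ r

/-- The length of a curve in the `L₁` metric of the plane. -/
noncomputable def l1Length {a b : Plane} (γ : Path a b) : ℝ≥0∞ :=
  eVariationOn (fun t : unitInterval => (WithLp.toLp 1 (fun i => γ t i) : PiLp 1 fun _ : Fin 2 => ℝ))
    Set.univ

/-- A feasible solution of the myopic watchman problem with discrete vision in `P`, with circular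
scan range `r`: a closed curve in `P` that starts and ends at `start`, and finitely many scan
points on it that cover `P`. -/
structure Solution (P : Set Plane) (r : ℝ) where
  start : Plane
  tour : Path start start
  tour_mem : ∀ t, tour t ∈ P
  scans : Finset Plane
  scans_on_tour : ∀ p ∈ scans, ∃ t, tour t = p
  covers : Covers P r (scans : Set Plane)

/-- The tour length of a solution, in the `L₁` metric. -/
noncomputable def Solution.length {P : Set Plane} {r : ℝ} (T : Solution P r) : ℝ≥0∞ :=
  l1Length T.tour

/-- The combined cost of a solution, if every scan costs `c`. -/
noncomputable def Solution.cost {P : Set Plane} {r : ℝ} (T : Solution P r) (c : ℝ≥0) : ℝ≥0∞ :=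
  c * (T.scans.card : ℝ≥0∞) + T.length

/-- The points with integer coordinates. -/
def gridPoints : Set Plane := {p | ∃ a b : ℤ, p 0 = a ∧ p 1 = b}

/-- The diagonal grid with offset `k`: the integer points whose coordinate sum is congruent to `k`
modulo 2. Neighbouring points have distance `√2`. -/
def diagonalGrid (k : ℤ) : Set Plane :=
  {p | ∃ a b : ℤ, p 0 = a ∧ p 1 = b ∧ a + b ≡ k [ZMOD 2]}

/-! Let `N` be the number of cells. Both bounds come from comparing lengths with `N`.

Upper bound. Take a spanning tree of the cells, in the graph of cells that share an edge, and walk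
once around the outside of this tree of cells. The walk has length `2 * N + 2`, stays on edges of
cells, and visits every corner of every cell, in particular the whole diagonal grid; it can start
at any corner. It is built cell by cell: the edge towards a new cell is replaced by the other three
edges of that cell (`IsAround.exists_insert`, `Polyomino.exists_isAround`).

Lower bound. The discs of radius `1` around the scan points of any solution cover the polyomino,
whose area is `N`. A disc of radius `1` that moves by `d` in the `L₁` metric sweeps an additional
area of at most `2 * d` (`volume_unitDisc_diff_le`). So, if one disc is fixed and the other scan
points are taken in the order of the tour, forwards and backwards in time, all the other discs
together add at most twice the length of the tour (`volume_biUnion_unitDisc_diff_le`). The fixed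
disc would contribute up to `π`, which is slightly too much. It is therefore chosen to cover the top
left corner of the leftmost cell in the top row; it then loses more than `π - 3` of its area outside
the polyomino (`Polyomino.volume_unitDisc_inter_extreme_le`). This yields `N ≤ 3 + 2 * L`, and
`2 * N + 2 ≤ 4 * L + 8` follows.

The number of scan points is compared locally: a closed unit disc contains at most four points of a
diagonal grid (`card_le_four_of_dist_le_one`), and each scan point of any solution covers only grid
points in its disc. The diagonal grid covers the polyomino as each cell has two opposite corners
in it. -/


/-! ### Sweeping a unit disc -/

open MeasureTheory

/-- The closed unit disc with centre `c`, in the product `ℝ × ℝ`, where Fubini is available. -/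
def unitDisc (c : ℝ × ℝ) : Set (ℝ × ℝ) := {x | (x.1 - c.1) ^ 2 + (x.2 - c.2) ^ 2 ≤ 1}

lemma isClosed_unitDisc (c : ℝ × ℝ) : IsClosed (unitDisc c) :=
  isClosed_le (by fun_prop) continuous_const

lemma measurableSet_unitDisc (c : ℝ × ℝ) : MeasurableSet (unitDisc c) :=
  (isClosed_unitDisc c).measurableSet

lemma volume_unitDisc (c : ℝ × ℝ) : volume (unitDisc c) = ENNReal.ofReal Real.pi := by
  have hpre : Complex.measurableEquivRealProd ⁻¹' unitDisc c =
      Metric.closedBall (Complex.mk c.1 c.2) 1 := by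
    ext z
    simp only [unitDisc, Set.mem_preimage, Complex.measurableEquivRealProd_apply,
      Set.mem_ofPred_eq, Metric.mem_closedBall, Complex.dist_eq_re_im]
    rw [Real.sqrt_le_one]
  rw [← Complex.volume_preserving_equiv_real_prod.measure_preimage_equiv, hpre,
    Complex.volume_closedBall]
  rw [ENNReal.ofReal_one, one_pow, one_mul, ENNReal.ofReal, Real.toNNReal_of_nonneg Real.pi_pos.le]
  rfl

/-- A chord of length `2 * √(1 - e ^ 2)` that is translated by `a' - a` gains at most `|a' - a|`. -/
lemma volume_chord_diff_le (a a' e : ℝ) :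
    volume {x : ℝ | (x - a') ^ 2 + e ^ 2 ≤ 1 ∧ ¬ (x - a) ^ 2 + e ^ 2 ≤ 1} ≤
      (Set.Icc (-1) 1).indicator (fun _ => ENNReal.ofReal |a' - a|) e := by
  by_cases he : e ∈ Set.Icc (-1 : ℝ) 1
  · rw [Set.indicator_of_mem he]
    have h0 : 0 ≤ 1 - e ^ 2 := by nlinarith [he.1, he.2]
    set h := √(1 - e ^ 2) with hh
    have hh0 : 0 ≤ h := Real.sqrt_nonneg _
    have hsq : h ^ 2 = 1 - e ^ 2 := Real.sq_sqrt h0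
    have key : ∀ x b : ℝ, (x - b) ^ 2 + e ^ 2 ≤ 1 ↔ b - h ≤ x ∧ x ≤ b + h := by
      intro x b
      rw [show (x - b) ^ 2 + e ^ 2 ≤ 1 ↔ (x - b) ^ 2 ≤ h ^ 2 by rw [hsq]; constructor <;> intro <;>
        linarith, sq_le_sq, abs_of_nonneg hh0, abs_le]
      constructor <;> rintro ⟨_, _⟩ <;> constructor <;> linarith
    simp only [key]
    rcases le_total a a' with haa | haa
    · calc _ ≤ volume (Set.Ioc (a + h) (a' + h)) := by
            apply measure_mono
            rintro x ⟨⟨h1, h2⟩, h3⟩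
            refine ⟨?_, h2⟩
            by_contra hx
            exact h3 ⟨by linarith, by linarith⟩
        _ = _ := by rw [Real.volume_Ioc, abs_of_nonneg (by linarith)]; ring_nf
    · calc _ ≤ volume (Set.Ico (a' - h) (a - h)) := by
            apply measure_mono
            rintro x ⟨⟨h1, h2⟩, h3⟩
            refine ⟨h1, ?_⟩
            by_contra hx
            exact h3 ⟨by linarith, by linarith⟩
        _ = _ := by rw [Real.volume_Ico, abs_of_nonpos (by linarith)]; ring_nf
  · rw [show {x : ℝ | (x - a') ^ 2 + e ^ 2 ≤ 1 ∧ ¬ (x - a) ^ 2 + e ^ 2 ≤ 1} = ∅ from ?_]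
    · simp
    · ext x
      simp only [Set.mem_ofPred_eq, Set.mem_empty_iff_false, iff_false, not_and]
      intro h1
      exact absurd ⟨by nlinarith [sq_nonneg (x - a')], by nlinarith [sq_nonneg (x - a')]⟩ he

lemma lintegral_indicator_sub (b : ℝ) (C : ℝ≥0∞) :
    ∫⁻ y, (Set.Icc (-1) 1).indicator (fun _ => C) (y - b) = 2 * C := by
  rw [lintegral_sub_right_eq_self (fun y => (Set.Icc (-1 : ℝ) 1).indicator (fun _ => C) y) b,
    lintegral_indicator_const measurableSet_Icc, Real.volume_Icc, mul_comm]
  norm_num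

/-- A unit disc that moves horizontally by `a' - a` sweeps at most `2 * |a' - a|`. -/
lemma volume_unitDisc_diff_fst (a a' b : ℝ) :
    volume (unitDisc (a', b) \ unitDisc (a, b)) ≤ 2 * ENNReal.ofReal |a' - a| := by
  rw [Measure.volume_eq_prod, Measure.prod_apply_symm
    ((measurableSet_unitDisc _).diff (measurableSet_unitDisc _)), ← lintegral_indicator_sub b]
  exact lintegral_mono fun y => volume_chord_diff_le a a' (y - b)

/-- A unit disc that moves vertically by `b' - b` sweeps at most `2 * |b' - b|`. -/
lemma volume_unitDisc_diff_snd (a b b' : ℝ) :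
    volume (unitDisc (a, b') \ unitDisc (a, b)) ≤ 2 * ENNReal.ofReal |b' - b| := by
  rw [Measure.volume_eq_prod, Measure.prod_apply
    ((measurableSet_unitDisc _).diff (measurableSet_unitDisc _)), ← lintegral_indicator_sub a]
  refine lintegral_mono fun x => le_trans (le_of_eq ?_) (volume_chord_diff_le b b' (x - a))
  congr 1
  ext y
  simp [unitDisc, add_comm]

/-- The coordinates of a point of the plane. -/
def coords (p : Plane) : ℝ × ℝ := (p 0, p 1)

/-- The points of the plane with the `L₁` metric. -/
noncomputable def toL1 (p : Plane) : PiLp 1 fun _ : Fin 2 => ℝ := WithLp.toLp 1 (fun i => p i)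

lemma edist_toL1 (p q : Plane) :
    edist (toL1 p) (toL1 q) = ENNReal.ofReal |p 0 - q 0| + ENNReal.ofReal |p 1 - q 1| := by
  rw [PiLp.edist_eq_of_L1, Fin.sum_univ_two]
  simp only [toL1, edist_dist, Real.dist_eq]

lemma l1Length_eq {a b : Plane} (γ : Path a b) :
    l1Length γ = eVariationOn (fun t => toL1 (γ t)) Set.univ := rfl

lemma volume_unitDisc_diff_le (p q : Plane) :
    volume (unitDisc (coords q) \ unitDisc (coords p)) ≤ 2 * edist (toL1 q) (toL1 p) := by
  have hsub : unitDisc (coords q) \ unitDisc (coords p) ⊆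
      (unitDisc (q 0, q 1) \ unitDisc (p 0, q 1)) ∪
        (unitDisc (p 0, q 1) \ unitDisc (p 0, p 1)) :=
    fun x hx => (em (x ∈ unitDisc (p 0, q 1))).elim (fun h => .inr ⟨h, hx.2⟩)
      (fun h => .inl ⟨hx.1, h⟩)
  rw [edist_toL1, mul_add]
  exact (measure_mono hsub).trans ((measure_union_le _ _).trans
    (add_le_add (volume_unitDisc_diff_fst _ _ _) (volume_unitDisc_diff_snd _ _ _)))

/-- Discs centred at finitely many later points of a curve add to the disc at time `t₀` at most
twice the length of the curve after `t₀`. -/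
lemma volume_biUnion_unitDisc_diff_forward {ι : Type*} [LinearOrder ι] [OrderTop ι]
    (γ : ι → Plane) (F : Finset ι) :
    ∀ t₀, (∀ t ∈ F, t₀ ≤ t) → volume ((⋃ t ∈ F, unitDisc (coords (γ t))) \ unitDisc (coords (γ t₀)))
      ≤ 2 * eVariationOn (fun t => toL1 (γ t)) (Set.Icc t₀ ⊤) := by
  induction F using Finset.induction_on_min with
  | empty => simp
  | insert a F ha ih =>
    intro t₀ ht₀
    have h0a : t₀ ≤ a := ht₀ a (by simp)
    have hsub : (⋃ t ∈ insert a F, unitDisc (coords (γ t))) \ unitDisc (coords (γ t₀)) ⊆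
        (unitDisc (coords (γ a)) \ unitDisc (coords (γ t₀))) ∪
          ((⋃ t ∈ F, unitDisc (coords (γ t))) \ unitDisc (coords (γ a))) := by
      rw [Finset.set_biUnion_insert]
      rintro x ⟨h1 | h1, h2⟩
      · exact .inl ⟨h1, h2⟩
      · by_cases h : x ∈ unitDisc (coords (γ a))
        · exact .inl ⟨h, h2⟩
        · exact .inr ⟨h1, h⟩
    refine (measure_mono hsub).trans ((measure_union_le _ _).trans ?_)
    have hadd := eVariationOn.Icc_add_Icc (fun t => toL1 (γ t)) (s := Set.univ) h0a
      (le_top : a ≤ ⊤) (Set.mem_univ a)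
    simp only [Set.univ_inter] at hadd
    rw [← hadd, mul_add]
    refine add_le_add ((volume_unitDisc_diff_le _ _).trans ?_) (ih a fun t ht => (ha t ht).le)
    gcongr
    exact eVariationOn.edist_le (fun t => toL1 (γ t)) (Set.right_mem_Icc.2 h0a)
      (Set.left_mem_Icc.2 h0a)

/-- Discs centred at finitely many earlier points of a curve add to the disc at time `t₀` at most
twice the length of the curve before `t₀`. -/
lemma volume_biUnion_unitDisc_diff_backward {ι : Type*} [LinearOrder ι] [OrderBot ι]
    (γ : ι → Plane) (F : Finset ι) (t₀ : ι) (h : ∀ t ∈ F, t ≤ t₀) :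
    volume ((⋃ t ∈ F, unitDisc (coords (γ t))) \ unitDisc (coords (γ t₀)))
      ≤ 2 * eVariationOn (fun t => toL1 (γ t)) (Set.Icc ⊥ t₀) := by
  have := volume_biUnion_unitDisc_diff_forward (ι := ιᵒᵈ) (fun t => γ (OrderDual.ofDual t))
    (F.map OrderDual.toDual.toEmbedding) (OrderDual.toDual t₀) (by simpa using h)
  have hvar := eVariationOn.comp_ofDual (fun t => toL1 (γ t)) (Set.Icc ⊥ t₀)
  have hset : Set.Icc (OrderDual.toDual t₀) ⊤ = OrderDual.ofDual ⁻¹' Set.Icc ⊥ t₀ := by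
    ext t
    simp
  rw [hset] at this
  simp only [Function.comp_def] at hvar
  rw [hvar, ← OrderDual.toDual.surjective.iUnion_comp] at this
  simpa using this

/-- Discs centred at finitely many points of a curve add to any one of its discs at most twice
the length of the curve. -/
lemma volume_biUnion_unitDisc_diff_le {a b : Plane} (γ : Path a b) (F : Finset unitInterval)
    (t₀ : unitInterval) :
    volume ((⋃ t ∈ F, unitDisc (coords (γ t))) \ unitDisc (coords (γ t₀))) ≤ 2 * l1Length γ := by
  have hsub : (⋃ t ∈ F, unitDisc (coords (γ t))) \ unitDisc (coords (γ t₀)) ⊆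
      ((⋃ t ∈ F.filter (· ≤ t₀), unitDisc (coords (γ t))) \ unitDisc (coords (γ t₀))) ∪
      ((⋃ t ∈ F.filter (t₀ ≤ ·), unitDisc (coords (γ t))) \ unitDisc (coords (γ t₀))) := by
    rintro x ⟨h1, h2⟩
    simp only [Set.mem_iUnion] at h1
    obtain ⟨t, ht, hx⟩ := h1
    rcases le_total t t₀ with h | h
    · exact .inl ⟨Set.mem_biUnion (Finset.mem_coe.2 (Finset.mem_filter.2 ⟨ht, h⟩)) hx, h2⟩
    · exact .inr ⟨Set.mem_biUnion (Finset.mem_coe.2 (Finset.mem_filter.2 ⟨ht, h⟩)) hx, h2⟩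
  have hadd := eVariationOn.Icc_add_Icc (fun t => toL1 (γ t)) (s := Set.univ)
    (bot_le : ⊥ ≤ t₀) le_top (Set.mem_univ t₀)
  simp only [Set.univ_inter, Set.Icc_bot_top] at hadd
  rw [l1Length_eq, ← hadd, mul_add]
  exact (measure_mono hsub).trans ((measure_union_le _ _).trans (add_le_add
    (volume_biUnion_unitDisc_diff_backward _ _ _ (by simp))
    (volume_biUnion_unitDisc_diff_forward _ _ _ (by simp))))

/-! ### The lower bound for the tour length -/

lemma dist_le_one_iff (p q : Plane) : dist p q ≤ 1 ↔ (p 0 - q 0) ^ 2 + (p 1 - q 1) ^ 2 ≤ 1 := by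
  rw [EuclideanSpace.dist_eq, Fin.sum_univ_two, Real.sqrt_le_one]
  simp only [Real.dist_eq, sq_abs]

namespace Polyomino

variable (P : Polyomino)

/-- The region of a polyomino in the product `ℝ × ℝ`. -/
def prodRegion : Set (ℝ × ℝ) :=
  ⋃ z ∈ P.cells, Set.Icc (z.1 : ℝ) (z.1 + 1) ×ˢ Set.Icc (z.2 : ℝ) (z.2 + 1)

variable {P}

lemma mem_region {p : Plane} : p ∈ P.region ↔
    ∃ z ∈ P.cells, (z.1 : ℝ) ≤ p 0 ∧ p 0 ≤ z.1 + 1 ∧ (z.2 : ℝ) ≤ p 1 ∧ p 1 ≤ z.2 + 1 := by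
  simp only [region, Set.mem_iUnion, exists_prop]
  rfl

lemma mem_prodRegion {x : ℝ × ℝ} : x ∈ P.prodRegion ↔
    ∃ z ∈ P.cells, (z.1 : ℝ) ≤ x.1 ∧ x.1 ≤ z.1 + 1 ∧ (z.2 : ℝ) ≤ x.2 ∧ x.2 ≤ z.2 + 1 := by
  simp only [prodRegion, Set.mem_iUnion, exists_prop, Set.mem_prod, Set.mem_Icc, and_assoc]

lemma cells_nonempty : P.cells.Nonempty :=
  let ⟨z⟩ := P.connected.nonempty
  ⟨z.1, z.2⟩

variable (P)

lemma card_cells_le_volume : (P.cells.card : ℝ≥0∞) ≤ volume P.prodRegion := by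
  have hmeas : ∀ z ∈ P.cells,
      MeasurableSet (Set.Ico (z.1 : ℝ) (z.1 + 1) ×ˢ Set.Ico (z.2 : ℝ) (z.2 + 1)) :=
    fun z _ => measurableSet_Ico.prod measurableSet_Ico
  have hdisj : Set.PairwiseDisjoint (P.cells : Set (ℤ × ℤ))
      fun z => Set.Ico (z.1 : ℝ) (z.1 + 1) ×ˢ Set.Ico (z.2 : ℝ) (z.2 + 1) := by
    intro z _ w _ hzw
    refine Set.disjoint_left.2 fun x hz hw => hzw ?_
    simp only [Set.mem_prod, ← Int.floor_eq_iff, Set.mem_Ico] at hz hw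
    exact Prod.ext (hz.1.symm.trans hw.1) (hz.2.symm.trans hw.2)
  have hvol := measure_biUnion_finset (μ := volume) hdisj hmeas
  simp only [Measure.volume_eq_prod, Measure.prod_prod, Real.volume_Ico, add_sub_cancel_left,
    ENNReal.ofReal_one, mul_one, Finset.sum_const, nsmul_eq_mul] at hvol
  rw [← hvol]
  exact measure_mono (Set.biUnion_mono subset_rfl fun z _ =>
    Set.prod_mono Set.Ico_subset_Icc_self Set.Ico_subset_Icc_self)

/-- The leftmost cell of the top row. -/
lemma exists_extreme_cell :
    ∃ z ∈ P.cells, (∀ w ∈ P.cells, w.2 ≤ z.2) ∧ (z.1 - 1, z.2) ∉ P.cells := by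
  obtain ⟨z, hz, hmax⟩ :=
    P.cells.exists_max_image (fun w => toLex (w.2, -w.1)) cells_nonempty
  refine ⟨z, hz, fun w hw => ?_, fun hl => ?_⟩
  · rcases Prod.Lex.toLex_le_toLex.1 (hmax w hw) with h | h
    · exact h.le
    · exact h.1.le
  · rcases Prod.Lex.toLex_le_toLex.1 (hmax _ hl) with h | h
    · exact lt_irrefl _ h
    · have := h.2
      simp only at this
      omega

variable {P}

lemma volume_unitDisc_inter_le {c : ℝ × ℝ} {Q : Set (ℝ × ℝ)} (hQ : MeasurableSet Q)
    (hsub : Q ⊆ unitDisc c) (hdisj : Disjoint Q P.prodRegion)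
    (hvol : ENNReal.ofReal 0.1416 ≤ volume Q) : volume (unitDisc c ∩ P.prodRegion) ≤ 3 := by
  have hQfin : volume Q ≠ ⊤ := ne_top_of_le_ne_top
    (by rw [volume_unitDisc]; exact ENNReal.ofReal_ne_top) (measure_mono hsub)
  calc volume (unitDisc c ∩ P.prodRegion) ≤ volume (unitDisc c \ Q) :=
        measure_mono fun x hx => ⟨hx.1, fun h => Set.disjoint_left.1 hdisj h hx.2⟩
    _ = ENNReal.ofReal Real.pi - volume Q := by
        rw [measure_sdiff hsub hQ.nullMeasurableSet hQfin, volume_unitDisc]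
    _ ≤ ENNReal.ofReal Real.pi - ENNReal.ofReal 0.1416 := tsub_le_tsub_left hvol _
    _ ≤ 3 := by
        rw [← ENNReal.ofReal_sub _ (by norm_num), show (3 : ℝ≥0∞) = ENNReal.ofReal 3 by norm_num]
        exact ENNReal.ofReal_le_ofReal (by linarith [Real.pi_lt_d4])

/-- A unit disc that covers the top left corner of the leftmost cell in the top row, and whose
centre is to the right of and below that corner, covers an area of at most `3` of the polyomino:
a rectangle of area more than `π - 3` above or to the left of the cell is lost. -/
lemma volume_unitDisc_inter_extreme_le {z : ℤ × ℤ} (htop : ∀ w ∈ P.cells, w.2 ≤ z.2)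
    (hleft : (z.1 - 1, z.2) ∉ P.cells) {c : ℝ × ℝ} (h1 : (z.1 : ℝ) ≤ c.1) (h2 : c.2 ≤ z.2 + 1)
    (hc : (c.1 - z.1) ^ 2 + (c.2 - (z.2 + 1)) ^ 2 ≤ 1) :
    volume (unitDisc c ∩ P.prodRegion) ≤ 3 := by
  -- If the centre is at most `0.7` below the top edge, a rectangle of area `1.04 * 0.14 = 0.1456`
  -- above that edge is lost. Otherwise the centre is at most `√(1 - 0.7 ^ 2) < 0.7142` to the right
  -- of the left edge, and a rectangle of area `0.22 * 0.65 = 0.143` to the left of it is lost.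
  by_cases hy : (z.2 : ℝ) + 1 - c.2 ≤ 0.7
  · refine volume_unitDisc_inter_le
      (Q := Set.Icc (c.1 - 0.52) (c.1 + 0.52) ×ˢ Set.Ioc ((z.2 : ℝ) + 1) (z.2 + 1 + 0.14))
      (measurableSet_Icc.prod measurableSet_Ioc) ?_ ?_ ?_
    · rintro x ⟨⟨hx1, hx2⟩, ⟨hx3, hx4⟩⟩
      change (x.1 - c.1) ^ 2 + (x.2 - c.2) ^ 2 ≤ 1
      nlinarith
    · refine Set.disjoint_left.2 ?_
      rintro x ⟨-, ⟨hx3, -⟩⟩ hx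
      obtain ⟨w, hw, -, -, -, hw2⟩ := mem_prodRegion.1 hx
      have : (w.2 : ℝ) ≤ z.2 := by exact_mod_cast htop w hw
      linarith
    · rw [Measure.volume_eq_prod, Measure.prod_prod, Real.volume_Icc, Real.volume_Ioc,
        ← ENNReal.ofReal_mul (by linarith)]
      exact ENNReal.ofReal_le_ofReal (by ring_nf; norm_num)
  · push Not at hy
    have hx : c.1 - z.1 ≤ 0.7142 := by nlinarith
    refine volume_unitDisc_inter_le
      (Q := Set.Ico ((z.1 : ℝ) - 0.22) z.1 ×ˢ Set.Ioo (z.2 : ℝ) (z.2 + 0.65))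
      (measurableSet_Ico.prod measurableSet_Ioo) ?_ ?_ ?_
    · rintro x ⟨⟨hx1, hx2⟩, ⟨hx3, hx4⟩⟩
      change (x.1 - c.1) ^ 2 + (x.2 - c.2) ^ 2 ≤ 1
      have hX : (x.1 - c.1) ^ 2 ≤ (c.1 - z.1 + 0.22) ^ 2 :=
        sq_le_sq' (by linarith) (by linarith)
      rcases le_total c.2 x.2 with hle | hle
      · have hY : (x.2 - c.2) ^ 2 ≤ (z.2 + 0.65 - c.2) ^ 2 := by
          apply pow_le_pow_left₀ <;> linarith
        nlinarith
      · nlinarith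
    · refine Set.disjoint_left.2 ?_
      rintro x ⟨⟨hx1, hx2⟩, ⟨hx3, hx4⟩⟩ hx
      obtain ⟨w, hw, hw1, hw2, hw3, hw4⟩ := mem_prodRegion.1 hx
      have e1 : w.1 < z.1 := by exact_mod_cast hw1.trans_lt hx2
      have e2 : z.1 < w.1 + 2 := by
        have : (z.1 : ℝ) < w.1 + 2 := by linarith
        exact_mod_cast this
      have e3 : z.2 < w.2 + 1 := by exact_mod_cast hx3.trans_le hw4
      have e4 := htop w hw
      exact hleft (by rwa [show (z.1 - 1, z.2) = w from Prod.ext (by simp; omega) (by simp; omega)])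
    · rw [Measure.volume_eq_prod, Measure.prod_prod, Real.volume_Ico, Real.volume_Ioo,
        ← ENNReal.ofReal_mul (by linarith)]
      exact ENNReal.ofReal_le_ofReal (by ring_nf; norm_num)

/-- The length of a tour with a covering set of scan points is at least `(N - 3) / 2`, where `N`
is the number of cells. -/
theorem card_cells_le (T : Solution P.region 1) :
    (P.cells.card : ℝ≥0∞) ≤ 3 + 2 * T.length := by
  classical
  obtain ⟨z, hz, htop, hleft⟩ := P.exists_extreme_cell
  set c : Plane := !₂[(z.1 : ℝ), (z.2 : ℝ) + 1] with hc
  have hc0 : c 0 = z.1 := rfl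
  have hc1 : c 1 = z.2 + 1 := rfl
  obtain ⟨p, hp, hseg, hdist⟩ := T.covers c
    (mem_region.2 ⟨z, hz, by rw [hc0], by rw [hc0]; linarith, by rw [hc1]; linarith, by rw [hc1]⟩)
  rw [dist_le_one_iff, hc0, hc1] at hdist
  have hpy : p 1 ≤ z.2 + 1 := by
    obtain ⟨w, hw, -, -, -, h⟩ := mem_region.1 (hseg (right_mem_segment ℝ c p))
    have : (w.2 : ℝ) ≤ z.2 := by exact_mod_cast htop w hw
    linarith
  -- To the left of the corner the segment from the corner to `p` would leave the polyomino.
  have hpx : (z.1 : ℝ) ≤ p 0 := by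
    by_contra! hlt
    obtain ⟨w, hw, hw1, hw2, hw3, hw4⟩ := mem_region.1 (hseg (midpoint_mem_segment c p))
    have m0 : (midpoint ℝ c p) 0 = (z.1 + p 0) / 2 := by
      simp [midpoint_eq_smul_add, hc0]; ring
    have m1 : (midpoint ℝ c p) 1 = (z.2 + 1 + p 1) / 2 := by
      simp [midpoint_eq_smul_add, hc1]; ring
    rw [m0] at hw1 hw2
    rw [m1] at hw3 hw4
    have b0 : -1 ≤ p 0 - z.1 := by nlinarith
    have b1 : -1 ≤ p 1 - (z.2 + 1) := by nlinarith
    have e1 : w.1 < z.1 := by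
      have : (w.1 : ℝ) < z.1 := by linarith
      exact_mod_cast this
    have e2 : z.1 < w.1 + 2 := by
      have : (z.1 : ℝ) < w.1 + 2 := by linarith
      exact_mod_cast this
    have e3 : z.2 < w.2 + 1 := by
      have : (z.2 : ℝ) < w.2 + 1 := by linarith
      exact_mod_cast this
    have e4 := htop w hw
    exact hleft (by rwa [show (z.1 - 1, z.2) = w from Prod.ext (by simp; omega) (by simp; omega)])
  have hstart : volume (unitDisc (coords p) ∩ P.prodRegion) ≤ 3 :=
    volume_unitDisc_inter_extreme_le htop hleft hpx hpy (by
      simp only [coords]; nlinarith)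
  choose! τ hτ using T.scans_on_tour
  have hcover : P.prodRegion ⊆ (unitDisc (coords p) ∩ P.prodRegion) ∪
      ((⋃ t ∈ T.scans.image τ, unitDisc (coords (T.tour t))) \
        unitDisc (coords (T.tour (τ p)))) := by
    intro x hx
    rw [hτ p hp]
    by_cases hxp : x ∈ unitDisc (coords p)
    · exact .inl ⟨hxp, hx⟩
    · refine .inr ⟨?_, hxp⟩
      obtain ⟨q, hq, -, hqd⟩ := T.covers !₂[x.1, x.2] (mem_region.2 (mem_prodRegion.1 hx))
      rw [dist_le_one_iff] at hqd
      refine Set.mem_biUnion (Finset.mem_coe.2 (Finset.mem_image_of_mem τ hq)) ?_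
      rw [hτ q hq]
      exact hqd
  calc (P.cells.card : ℝ≥0∞) ≤ volume P.prodRegion := P.card_cells_le_volume
    _ ≤ _ := measure_mono hcover
    _ ≤ _ := measure_union_le _ _
    _ ≤ 3 + 2 * T.length :=
        add_le_add hstart (volume_biUnion_unitDisc_diff_le T.tour (T.scans.image τ) (τ p))

end Polyomino

/-! ### A grid walk around a spanning tree of the cells -/

/-- `v` is one of the four corners of the pixel `z`. -/
def IsPixelCorner (z v : ℤ × ℤ) : Prop :=
  z.1 ≤ v.1 ∧ v.1 ≤ z.1 + 1 ∧ z.2 ≤ v.2 ∧ v.2 ≤ z.2 + 1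

lemma pixelGraph_adj_iff {z w : ℤ × ℤ} : pixelGraph.Adj z w ↔
    (w.1 = z.1 + 1 ∨ w.1 = z.1 - 1) ∧ w.2 = z.2 ∨ w.1 = z.1 ∧ (w.2 = z.2 + 1 ∨ w.2 = z.2 - 1) := by
  change |z.1 - w.1| + |z.2 - w.2| = 1 ↔ _
  rcases abs_cases (z.1 - w.1) with h1 | h1 <;> rcases abs_cases (z.2 - w.2) with h2 | h2 <;> omega

/-- A passage of a walk through the edge `uv` is replaced by the detour `u`, `u'`, `v'`, `v`. -/
lemma SimpleGraph.Walk.exists_detour {V : Type*} {G : SimpleGraph V} {u u' v' v : V}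
    (h1 : G.Adj u u') (h2 : G.Adj u' v') (h3 : G.Adj v' v) {a b : V} (p : G.Walk a b)
    (hp : s(u, v) ∈ p.edges) :
    ∃ q : G.Walk a b, q.length = p.length + 2 ∧
      (∀ x ∈ p.support, x ∈ q.support) ∧ u' ∈ q.support ∧ v' ∈ q.support ∧
      (∀ e ∈ p.edges, e ≠ s(u, v) → e ∈ q.edges) ∧
      (s(u, u') ∈ q.edges ∧ s(u', v') ∈ q.edges ∧ s(v', v) ∈ q.edges) ∧
      ∀ e ∈ q.edges, e ∈ p.edges ∨ e = s(u, u') ∨ e = s(u', v') ∨ e = s(v', v) := by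
  induction p with
  | nil => simp at hp
  | @cons a c b h p ih =>
    by_cases hac : s(a, c) = s(u, v)
    · rcases Sym2.eq_iff.1 hac with ⟨rfl, rfl⟩ | ⟨rfl, rfl⟩
      · refine ⟨.cons h1 (.cons h2 (.cons h3 p)), ?_⟩
        simp only [SimpleGraph.Walk.length_cons, SimpleGraph.Walk.support_cons,
          SimpleGraph.Walk.edges_cons, List.mem_cons]
        exact ⟨trivial, by grind⟩
      · refine ⟨.cons h3.symm (.cons h2.symm (.cons h1.symm p)), ?_⟩
        simp only [SimpleGraph.Walk.length_cons, SimpleGraph.Walk.support_cons,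
          SimpleGraph.Walk.edges_cons, List.mem_cons]
        exact ⟨trivial, by grind [Sym2.eq_swap]⟩
    · rw [SimpleGraph.Walk.edges_cons, List.mem_cons] at hp
      obtain ⟨q, hq⟩ := ih (hp.resolve_left (Ne.symm hac))
      refine ⟨.cons h q, ?_⟩
      simp only [SimpleGraph.Walk.length_cons, SimpleGraph.Walk.support_cons,
          SimpleGraph.Walk.edges_cons, List.mem_cons]
      exact ⟨by omega, by grind⟩

/-- The closed walk `p` on grid points runs along the edges of the cells in `S`, as it would around
the outside of a tree of cells: each cell accounts for two steps, each corner is visited, and so is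
each edge that separates a cell of `S` from a cell outside `S`. -/
structure IsAround (S : Finset (ℤ × ℤ)) {s : ℤ × ℤ} (p : pixelGraph.Walk s s) : Prop where
  length_eq : p.length = 2 * S.card + 2
  corner_mem : ∀ z ∈ S, ∀ v, IsPixelCorner z v → v ∈ p.support
  edge_subset : ∀ u v, s(u, v) ∈ p.edges → ∃ z ∈ S, IsPixelCorner z u ∧ IsPixelCorner z v
  boundary_mem : ∀ z ∈ S, ∀ w ∉ S, pixelGraph.Adj z w → ∀ u v, pixelGraph.Adj u v →
    IsPixelCorner z u → IsPixelCorner w u → IsPixelCorner z v → IsPixelCorner w v → s(u, v) ∈ p.edges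

lemma exists_isAround_singleton {z s : ℤ × ℤ} (hs : IsPixelCorner z s) :
    ∃ p : pixelGraph.Walk s s, IsAround {z} p := by
  obtain ⟨a, b⟩ := z
  obtain ⟨x, y⟩ := s
  obtain ⟨g1, g2, g3, g4⟩ := hs
  simp only at g1 g2 g3 g4
  -- `(x', y')` is the corner opposite to `(x, y)`.
  obtain ⟨x', hx⟩ : ∃ x', x = a ∧ x' = a + 1 ∨ x = a + 1 ∧ x' = a := ⟨2 * a + 1 - x, by omega⟩
  obtain ⟨y', hy⟩ : ∃ y', y = b ∧ y' = b + 1 ∨ y = b + 1 ∧ y' = b := ⟨2 * b + 1 - y, by omega⟩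
  have hx' : x' = x + 1 ∨ x' = x - 1 := by omega
  have hy' : y' = y + 1 ∨ y' = y - 1 := by omega
  have hcorner : ∀ v w, IsPixelCorner (a, b) (v, w) ↔ (v = x ∨ v = x') ∧ (w = y ∨ w = y') := by
    intro v w
    simp only [IsPixelCorner]
    omega
  have h1 : pixelGraph.Adj (x, y) (x', y) := pixelGraph_adj_iff.2 (.inl ⟨hx', rfl⟩)
  have h2 : pixelGraph.Adj (x', y) (x', y') := pixelGraph_adj_iff.2 (.inr ⟨rfl, hy'⟩)
  have h3 : pixelGraph.Adj (x, y') (x', y') := pixelGraph_adj_iff.2 (.inl ⟨hx', rfl⟩)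
  have h4 : pixelGraph.Adj (x, y) (x, y') := pixelGraph_adj_iff.2 (.inr ⟨rfl, hy'⟩)
  refine ⟨.cons h1 (.cons h2 (.cons h3.symm (.cons h4.symm .nil))), ?_, ?_, ?_, ?_⟩
  · simp
  · rintro _ hz ⟨v, w⟩ hv
    rw [Finset.mem_singleton] at hz
    subst hz
    rw [hcorner] at hv
    obtain ⟨rfl | rfl, rfl | rfl⟩ := hv <;> simp
  · rintro ⟨u, u'⟩ ⟨v, v'⟩ he
    refine ⟨_, Finset.mem_singleton_self _, ?_⟩
    simp only [SimpleGraph.Walk.edges_cons, SimpleGraph.Walk.edges_nil, List.mem_cons,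
      Sym2.eq_iff, Prod.mk.injEq, List.not_mem_nil, or_false] at he
    rw [hcorner, hcorner]
    rcases he with (⟨⟨rfl, rfl⟩, rfl, rfl⟩ | ⟨⟨rfl, rfl⟩, rfl, rfl⟩) |
      (⟨⟨rfl, rfl⟩, rfl, rfl⟩ | ⟨⟨rfl, rfl⟩, rfl, rfl⟩) |
      (⟨⟨rfl, rfl⟩, rfl, rfl⟩ | ⟨⟨rfl, rfl⟩, rfl, rfl⟩) |
      (⟨⟨rfl, rfl⟩, rfl, rfl⟩ | ⟨⟨rfl, rfl⟩, rfl, rfl⟩) <;> simp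
  · rintro _ hz w - - ⟨u, u'⟩ ⟨v, v'⟩ huv hu - hv -
    rw [Finset.mem_singleton] at hz
    subst hz
    rw [hcorner] at hu hv
    rw [pixelGraph_adj_iff] at huv
    simp only at huv
    simp only [SimpleGraph.Walk.edges_cons, SimpleGraph.Walk.edges_nil, List.mem_cons,
      List.not_mem_nil, or_false]
    clear h1 h2 h3 h4 hcorner g1 g2 g3 g4 hx hy
    obtain ⟨rfl | rfl, rfl | rfl⟩ := hu <;> obtain ⟨rfl | rfl, rfl | rfl⟩ := hv <;>
      first
      | (exfalso; omega)
      | simp [Sym2.eq_swap]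

/-- The walk is extended to a cell `w` that is adjacent to a cell `z` of `S`: the common edge is
replaced by the other three edges of `w`. -/
lemma IsAround.exists_insert {S : Finset (ℤ × ℤ)} {s : ℤ × ℤ} {p : pixelGraph.Walk s s}
    (hp : IsAround S p) {z w : ℤ × ℤ} (hz : z ∈ S) (hw : w ∉ S) (hzw : pixelGraph.Adj z w) :
    ∃ q : pixelGraph.Walk s s, IsAround (insert w S) q := by
  -- The common edge is `uv`, and `u'v'` is the opposite edge of `w`.
  obtain ⟨u, v, u', v', huv, hzu, hwu, hzv, hwv, hu', hv', h1, h2, h3, hall⟩ :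
      ∃ u v u' v' : ℤ × ℤ, pixelGraph.Adj u v ∧ IsPixelCorner z u ∧ IsPixelCorner w u ∧ IsPixelCorner z v ∧ IsPixelCorner w v ∧
        IsPixelCorner w u' ∧ IsPixelCorner w v' ∧ pixelGraph.Adj u u' ∧ pixelGraph.Adj u' v' ∧
        pixelGraph.Adj v' v ∧ ∀ x, IsPixelCorner w x → x = u ∨ x = v ∨ x = u' ∨ x = v' := by
    obtain ⟨a, b⟩ := z
    obtain ⟨c, d⟩ := w
    rw [pixelGraph_adj_iff] at hzw
    simp only [IsPixelCorner, pixelGraph_adj_iff, Prod.ext_iff]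
    obtain ⟨h | h, h'⟩ | ⟨h', h | h⟩ := hzw <;> simp only at h h'
    · refine ⟨(a + 1, b), (a + 1, b + 1), (a + 2, b), (a + 2, b + 1), ?_⟩
      and_intros <;> omega
    · refine ⟨(a, b), (a, b + 1), (a - 1, b), (a - 1, b + 1), ?_⟩
      and_intros <;> omega
    · refine ⟨(a, b + 1), (a + 1, b + 1), (a, b + 2), (a + 1, b + 2), ?_⟩
      and_intros <;> omega
    · refine ⟨(a, b), (a + 1, b), (a, b - 1), (a + 1, b - 1), ?_⟩
      and_intros <;> omega
  obtain ⟨q, hlen, hsup, hsu, hsv, hedge, ⟨e1, e2, e3⟩, hsub⟩ :=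
    p.exists_detour h1 h2 h3 (hp.boundary_mem z hz w hw hzw u v huv hzu hwu hzv hwv)
  refine ⟨q, ?_, ?_, ?_, ?_⟩
  · rw [hlen, hp.length_eq, Finset.card_insert_of_notMem hw]
    ring
  · intro x hx y hy
    rcases Finset.mem_insert.1 hx with rfl | hx
    · rcases hall y hy with rfl | rfl | rfl | rfl
      · exact hsup _ (hp.corner_mem z hz _ hzu)
      · exact hsup _ (hp.corner_mem z hz _ hzv)
      · exact hsu
      · exact hsv
    · exact hsup _ (hp.corner_mem x hx y hy)
  · intro x y he
    rcases hsub _ he with he | he | he | he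
    · obtain ⟨t, ht, h⟩ := hp.edge_subset x y he
      exact ⟨t, Finset.mem_insert_of_mem ht, h⟩
    all_goals
      refine ⟨w, Finset.mem_insert_self _ _, ?_⟩
      rcases Sym2.eq_iff.1 he with ⟨rfl, rfl⟩ | ⟨rfl, rfl⟩ <;> constructor <;> assumption
  · intro t ht r hr htr x y hxy htx hrx hty hry
    rw [Finset.mem_insert, not_or] at hr
    have hne : s(x, y) ≠ s(u, v) := by
      -- The edge `uv` only belongs to the two cells `z` and `w`, and `r` is neither of them.
      intro heq
      have hcr : IsPixelCorner r u ∧ IsPixelCorner r v := by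
        rcases Sym2.eq_iff.1 heq with ⟨rfl, rfl⟩ | ⟨rfl, rfl⟩ <;> constructor <;> assumption
      have hrz : r ≠ z := fun h => hr.2 (h ▸ hz)
      have hrw := hr.1
      have hzw' := hzw.ne
      have huv' := huv.ne
      obtain ⟨hru, hrv⟩ := hcr
      clear hall hedge hsub hsup
      simp only [IsPixelCorner] at *
      simp only [ne_eq, Prod.ext_iff] at hrz hrw hzw' huv'
      omega
    rcases Finset.mem_insert.1 ht with rfl | ht
    · have hx := hall x htx
      have hy := hall y hty
      have p1 := pixelGraph_adj_iff.1 hxy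
      have p2 := pixelGraph_adj_iff.1 h1
      have p3 := pixelGraph_adj_iff.1 h2
      have p4 := pixelGraph_adj_iff.1 h3
      have hxy' := hxy.ne
      rcases hx with rfl | rfl | rfl | rfl <;> rcases hy with rfl | rfl | rfl | rfl <;>
        first
        | exact absurd rfl hxy'
        | exact absurd rfl hne
        | exact absurd Sym2.eq_swap hne
        | assumption
        | (rw [Sym2.eq_swap]; assumption)
        | (exfalso; omega)
    · exact hedge _ (hp.boundary_mem t ht r hr.2 htr x y hxy htx hrx hty hry) hne

/-- A closed walk around all cells of a polyomino, from any of its corners. -/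
lemma Polyomino.exists_isAround (P : Polyomino) {z s : ℤ × ℤ} (hz : z ∈ P.cells)
    (hs : IsPixelCorner z s) : ∃ p : pixelGraph.Walk s s, IsAround P.cells p := by
  classical
  -- The cells around which there is such a walk are taken maximal.
  obtain ⟨S, hS, hmax⟩ := (P.cells.powerset.filter fun S =>
    z ∈ S ∧ ∃ p : pixelGraph.Walk s s, IsAround S p).exists_max_image Finset.card
    ⟨{z}, by simpa [hz] using exists_isAround_singleton hs⟩
  simp only [Finset.mem_filter, Finset.mem_powerset] at hS hmax
  obtain ⟨hSP, hzS, p, hp⟩ := hS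
  by_cases hSeq : S = P.cells
  · exact ⟨p, hSeq ▸ hp⟩
  · obtain ⟨w, hw, hwS⟩ := Finset.exists_of_ssubset (hSP.ssubset_of_ne hSeq)
    obtain ⟨r⟩ := P.connected.preconnected ⟨z, hz⟩ ⟨w, hw⟩
    obtain ⟨d, -, hd1, hd2⟩ := r.exists_boundary_dart {x | x.1 ∈ S} hzS hwS
    obtain ⟨q, hq⟩ := hp.exists_insert hd1 hd2 d.adj
    have := hmax (insert d.snd.1 S) ⟨Finset.insert_subset d.snd.2 hSP,
      Finset.mem_insert_of_mem hzS, q, hq⟩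
    rw [Finset.card_insert_of_notMem hd2] at this
    omega

/-! ### Curves along grid walks -/

lemma l1Length_refl (a : Plane) : l1Length (Path.refl a) = 0 := by
  rw [l1Length_eq]
  exact eVariationOn.constant_on (Set.subsingleton_of_forall_eq (toL1 a) (by simp))

lemma l1Length_segment_le (a b : Plane) :
    l1Length (Path.segment a b) ≤ edist (toL1 a) (toL1 b) := by
  have hlip : LipschitzOnWith (nndist (toL1 a) (toL1 b))
      (fun t : ℝ => AffineMap.lineMap (k := ℝ) (toL1 a) (toL1 b) t) Set.univ :=
    (lipschitzWith_lineMap _ _).lipschitzOnWith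
  have hcomp := hlip.comp_eVariationOn_le (g := fun t : unitInterval => (t : ℝ))
    (s := Set.univ) (Set.mapsTo_univ _ _)
  have hmono := MonotoneOn.eVariationOn_eq (f := fun t : unitInterval => (t : ℝ)) (s := Set.univ)
    (fun x _ y _ h => h) (Set.mem_univ 0) (Set.mem_univ 1)
  simp only [Set.univ_inter] at hmono
  have h01 : Set.Icc (0 : unitInterval) 1 = Set.univ := Set.Icc_bot_top
  rw [h01] at hmono
  have heq : (fun t => toL1 (Path.segment a b t)) =
      (fun t : ℝ => AffineMap.lineMap (k := ℝ) (toL1 a) (toL1 b) t) ∘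
        (fun t : unitInterval => (t : ℝ)) := by
    ext t i
    simp [toL1, AffineMap.lineMap_apply]
  rw [l1Length_eq, heq]
  refine hcomp.trans ((mul_le_mul_right hmono.le _).trans (le_of_eq ?_))
  rw [Set.Icc.coe_one, Set.Icc.coe_zero, sub_zero, ENNReal.ofReal_one, mul_one,
    edist_nndist]

lemma l1Length_trans_le {a b c : Plane} (γ : Path a b) (γ' : Path b c) :
    l1Length (γ.trans γ') ≤ l1Length γ + l1Length γ' := by
  set m : unitInterval := ⟨1 / 2, by norm_num, by norm_num⟩ with hm
  have hadd := eVariationOn.Icc_add_Icc (fun t => toL1 (γ.trans γ' t)) (s := Set.univ)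
    (bot_le : ⊥ ≤ m) le_top (Set.mem_univ m)
  simp only [Set.univ_inter, Set.Icc_bot_top] at hadd
  rw [l1Length_eq, ← hadd, l1Length_eq, l1Length_eq]
  refine add_le_add ?_ ?_
  · have heq : Set.EqOn (fun t => toL1 (γ.trans γ' t))
        ((fun t => toL1 (γ t)) ∘ fun t : unitInterval => Set.projIcc 0 1 zero_le_one (2 * (t : ℝ)))
        (Set.Icc ⊥ m) := by
      rintro t ⟨-, ht⟩
      have ht' : (t : ℝ) ≤ 1 / 2 := ht
      simp only [Function.comp_apply, Path.trans_apply, ht', dif_pos]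
      rw [Set.projIcc_of_mem]
    rw [eVariationOn.congr heq]
    refine eVariationOn.comp_le_of_monotoneOn _ _ ?_ (Set.mapsTo_univ _ _)
    intro x _ y _ hxy
    exact Set.monotone_projIcc _ (by have : (x : ℝ) ≤ y := hxy; linarith)
  · have heq : Set.EqOn (fun t => toL1 (γ.trans γ' t))
        ((fun t => toL1 (γ' t)) ∘
          fun t : unitInterval => Set.projIcc 0 1 zero_le_one (2 * (t : ℝ) - 1))
        (Set.Icc m ⊤) := by
      rintro t ⟨ht, -⟩
      have ht' : 1 / 2 ≤ (t : ℝ) := ht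
      have hmem : 2 * (t : ℝ) - 1 ∈ Set.Icc (0 : ℝ) 1 := ⟨by linarith, by linarith [t.2.2]⟩
      simp only [Function.comp_apply, Path.trans_apply]
      split_ifs with h
      · have h2 : (t : ℝ) = 1 / 2 := le_antisymm h ht'
        have e1 : (⟨2 * (t : ℝ), (unitInterval.mul_pos_mem_iff zero_lt_two).2 ⟨t.2.1, h⟩⟩ :
          unitInterval) = 1 := Subtype.ext (by simp [h2])
        have e2 : Set.projIcc (0 : ℝ) 1 zero_le_one (2 * (t : ℝ) - 1) = 0 := by
          rw [Set.projIcc_of_mem _ hmem]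
          exact Subtype.ext (by simp [h2])
        rw [e1, e2, γ.target, γ'.source]
      · rw [Set.projIcc_of_mem _ hmem]
    rw [eVariationOn.congr heq]
    refine eVariationOn.comp_le_of_monotoneOn _ _ ?_ (Set.mapsTo_univ _ _)
    intro x _ y _ hxy
    exact Set.monotone_projIcc _ (by have : (x : ℝ) ≤ y := hxy; linarith)

/-- The point of the plane with the integer coordinates `v`. -/
noncomputable def gridPoint (v : ℤ × ℤ) : Plane := !₂[(v.1 : ℝ), (v.2 : ℝ)]

@[simp] lemma gridPoint_zero (v : ℤ × ℤ) : gridPoint v 0 = v.1 := rfl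

@[simp] lemma gridPoint_one (v : ℤ × ℤ) : gridPoint v 1 = v.2 := rfl

lemma edist_gridPoint_of_adj {u v : ℤ × ℤ} (h : pixelGraph.Adj u v) :
    edist (toL1 (gridPoint u)) (toL1 (gridPoint v)) = 1 := by
  rw [edist_toL1, ← ENNReal.ofReal_add (abs_nonneg _) (abs_nonneg _)]
  have : |u.1 - v.1| + |u.2 - v.2| = 1 := h
  simp only [gridPoint_zero, gridPoint_one]
  rw [show |(u.1 : ℝ) - v.1| + |(u.2 : ℝ) - v.2| = 1 by exact_mod_cast this, ENNReal.ofReal_one]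

/-- The polygonal curve along a walk on grid points. -/
noncomputable def walkPath : {a b : ℤ × ℤ} → pixelGraph.Walk a b →
    Path (gridPoint a) (gridPoint b)
  | _, _, .nil => Path.refl _
  | a, _, .cons (v := c) _ p => (Path.segment (gridPoint a) (gridPoint c)).trans (walkPath p)

lemma l1Length_walkPath_le {a b : ℤ × ℤ} (p : pixelGraph.Walk a b) :
    l1Length (walkPath p) ≤ p.length := by
  induction p with
  | nil => rw [walkPath, l1Length_refl]; exact zero_le
  | cons h p ih =>
    rw [walkPath, SimpleGraph.Walk.length_cons, Nat.cast_add, Nat.cast_one, add_comm]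
    refine (l1Length_trans_le _ _).trans (add_le_add ?_ ih)
    exact (l1Length_segment_le _ _).trans (edist_gridPoint_of_adj h).le

lemma gridPoint_mem_range_walkPath {a b : ℤ × ℤ} (p : pixelGraph.Walk a b) :
    ∀ v ∈ p.support, gridPoint v ∈ Set.range (walkPath p) := by
  induction p with
  | nil =>
    intro v hv
    rw [SimpleGraph.Walk.support_nil, List.mem_singleton] at hv
    subst hv
    exact ⟨0, (walkPath _).source⟩
  | cons h p ih =>
    intro v hv
    rw [SimpleGraph.Walk.support_cons, List.mem_cons] at hv
    rcases hv with rfl | hv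
    · exact ⟨0, (walkPath _).source⟩
    · rw [walkPath, Path.trans_range]
      exact .inr (ih v hv)

lemma range_walkPath_subset {a b : ℤ × ℤ} (p : pixelGraph.Walk a b) {R : Set Plane}
    (ha : gridPoint a ∈ R)
    (hR : ∀ u v, s(u, v) ∈ p.edges → segment ℝ (gridPoint u) (gridPoint v) ⊆ R) :
    Set.range (walkPath p) ⊆ R := by
  induction p with
  | nil => simpa [walkPath] using ha
  | @cons a c b h p ih =>
    rw [walkPath, Path.trans_range, Path.range_segment]
    have hac := hR a c (by simp)
    exact Set.union_subset hac (ih (hac (right_mem_segment ℝ _ _)) fun u v he =>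
      hR u v (by simp [he]))

lemma convex_pixel (z : ℤ × ℤ) : Convex ℝ (pixel z) := by
  rintro p ⟨p1, p2, p3, p4⟩ q ⟨q1, q2, q3, q4⟩ s t hs ht hst
  simp only [pixel, Set.mem_ofPred_eq, PiLp.add_apply, PiLp.smul_apply, smul_eq_mul]
  have : s = 1 - t := by linarith
  subst this
  refine ⟨?_, ?_, ?_, ?_⟩ <;> nlinarith

lemma gridPoint_mem_pixel {z v : ℤ × ℤ} : gridPoint v ∈ pixel z ↔ IsPixelCorner z v := by
  simp only [pixel, Set.mem_ofPred_eq, gridPoint_zero, gridPoint_one, IsPixelCorner]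
  exact_mod_cast Iff.rfl

lemma Polyomino.gridPoint_mem_region {P : Polyomino} {v : ℤ × ℤ} :
    gridPoint v ∈ P.region ↔ ∃ z ∈ P.cells, IsPixelCorner z v := by
  simp only [Polyomino.region, Set.mem_iUnion, exists_prop, gridPoint_mem_pixel]

lemma Polyomino.segment_subset_region {P : Polyomino} {z : ℤ × ℤ} (hz : z ∈ P.cells) {p q : Plane}
    (hp : p ∈ pixel z) (hq : q ∈ pixel z) : segment ℝ p q ⊆ P.region :=
  ((convex_pixel z).segment_subset hp hq).trans (Set.subset_biUnion_of_mem (Finset.mem_coe.2 hz))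

/-! ### Scan points on a diagonal grid -/

lemma mem_diagonalGrid {k : ℤ} {p : Plane} :
    p ∈ diagonalGrid k ↔ ∃ v : ℤ × ℤ, v.1 + v.2 ≡ k [ZMOD 2] ∧ gridPoint v = p := by
  constructor
  · rintro ⟨a, b, h0, h1, h⟩
    refine ⟨(a, b), h, ?_⟩
    ext i
    fin_cases i
    · exact h0.symm
    · exact h1.symm
  · rintro ⟨v, h, rfl⟩
    exact ⟨v.1, v.2, rfl, rfl, h⟩

/-- The unit discs around two opposite corners of a pixel cover the pixel. -/
lemma Polyomino.covers_diagonalGrid (P : Polyomino) (k : ℤ) :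
    Covers P.region 1 (diagonalGrid k ∩ P.region) := by
  intro q hq
  obtain ⟨z, hz, hqz⟩ : ∃ z ∈ P.cells, q ∈ pixel z := by
    simpa only [Polyomino.region, Set.mem_iUnion, exists_prop] using hq
  obtain ⟨g1, g2, g3, g4⟩ := hqz
  have hcorner : ∀ v, v.1 + v.2 ≡ k [ZMOD 2] → IsPixelCorner z v → dist q (gridPoint v) ≤ 1 →
      ∃ p ∈ diagonalGrid k ∩ P.region, segment ℝ q p ⊆ P.region ∧ dist q p ≤ 1 :=
    fun v hv hzv hd => ⟨gridPoint v, ⟨mem_diagonalGrid.2 ⟨v, hv, rfl⟩,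
      P.gridPoint_mem_region.2 ⟨z, hz, hzv⟩⟩,
      Polyomino.segment_subset_region hz ⟨g1, g2, g3, g4⟩ (gridPoint_mem_pixel.2 hzv), hd⟩
  obtain ⟨a, b⟩ := z
  simp only at g1 g2 g3 g4
  rcases Int.emod_two_eq_zero_or_one (a + b - k) with h | h
  · by_cases hd : (q 0 - a) ^ 2 + (q 1 - b) ^ 2 ≤ 1
    · refine hcorner (a, b) (Int.modEq_iff_dvd.2 (by simp only; omega))
        (by simp [IsPixelCorner]) ((dist_le_one_iff _ _).2 hd)
    · refine hcorner (a + 1, b + 1) (Int.modEq_iff_dvd.2 (by simp only; omega))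
        (by simp [IsPixelCorner]) ((dist_le_one_iff _ _).2 ?_)
      simp only [gridPoint_zero, gridPoint_one]
      push_cast
      nlinarith
  · by_cases hd : (q 0 - (a + 1)) ^ 2 + (q 1 - b) ^ 2 ≤ 1
    · refine hcorner (a + 1, b) (Int.modEq_iff_dvd.2 (by simp only; omega))
        (by simp [IsPixelCorner]) ((dist_le_one_iff _ _).2 (by simpa using hd))
    · refine hcorner (a, b + 1) (Int.modEq_iff_dvd.2 (by simp only; omega))
        (by simp [IsPixelCorner]) ((dist_le_one_iff _ _).2 ?_)
      simp only [gridPoint_zero, gridPoint_one]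
      push_cast
      nlinarith

/-- A closed unit disc contains at most four points of a diagonal grid: in the coordinates `a + b`
and `a - b` the grid has mesh `2`, and the disc lies in a square of side `2 * √2 < 4`. -/
lemma card_le_four_of_dist_le_one {k : ℤ} {p : Plane} {S : Finset Plane}
    (hS : ∀ q ∈ S, q ∈ diagonalGrid k ∧ dist q p ≤ 1) : S.card ≤ 4 := by
  classical
  set c : ℤ := ⌈(p 0 + p 1 - k) / 2 - 3 / 4⌉ with hc
  set d : ℤ := ⌈(p 0 - p 1 - k) / 2 - 3 / 4⌉ with hd
  have hsub : S ⊆ (({c, c + 1} : Finset ℤ) ×ˢ ({d, d + 1} : Finset ℤ)).image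
      fun j => gridPoint (k + j.1 + j.2, j.1 - j.2) := by
    intro q hq
    obtain ⟨hqk, hqp⟩ := hS q hq
    obtain ⟨⟨a, b⟩, hab, rfl⟩ := mem_diagonalGrid.1 hqk
    rw [dist_le_one_iff] at hqp
    simp only [gridPoint_zero, gridPoint_one] at hqp
    obtain ⟨x, hx⟩ : ∃ x, a + b = k + 2 * x := by
      obtain ⟨x, hx⟩ := Int.modEq_iff_dvd.1 hab.symm
      exact ⟨x, by simp only at hx; omega⟩
    obtain ⟨y, hy⟩ : ∃ y, a - b = k + 2 * y := ⟨x - b, by omega⟩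
    -- A number of the form `⌈t - 3 / 4⌉` or its successor is each integer within `3 / 4` of `t`.
    have key : ∀ (n : ℤ) (t : ℝ), |n - t| ≤ 3 / 4 →
        n = ⌈t - 3 / 4⌉ ∨ n = ⌈t - 3 / 4⌉ + 1 := by
      intro n t hnt
      rw [abs_le] at hnt
      have h1 : ⌈t - 3 / 4⌉ ≤ n := Int.ceil_le.2 (by linarith)
      have h2 : n < ⌈t - 3 / 4⌉ + 2 := by
        have : (n : ℝ) < ⌈t - 3 / 4⌉ + 2 := by linarith [Int.le_ceil (t - 3 / 4)]
        exact_mod_cast this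
      omega
    have hx' : (a : ℝ) + b = k + 2 * x := by exact_mod_cast hx
    have hy' : (a : ℝ) - b = k + 2 * y := by exact_mod_cast hy
    have hxc := key x ((p 0 + p 1 - k) / 2) (by
      rw [show (x : ℝ) - (p 0 + p 1 - k) / 2 = ((a - p 0) + (b - p 1)) / 2 by linarith]
      apply abs_le_of_sq_le_sq _ (by norm_num)
      nlinarith [sq_nonneg ((a - p 0) - (b - p 1))])
    have hyd := key y ((p 0 - p 1 - k) / 2) (by
      rw [show (y : ℝ) - (p 0 - p 1 - k) / 2 = ((a - p 0) - (b - p 1)) / 2 by linarith]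
      apply abs_le_of_sq_le_sq _ (by norm_num)
      nlinarith [sq_nonneg ((a - p 0) + (b - p 1))])
    refine Finset.mem_image.2 ⟨(x, y), ?_, ?_⟩
    · simp only [Finset.mem_product, Finset.mem_insert, Finset.mem_singleton]
      exact ⟨hxc, hyd⟩
    · congr 1
      ext <;> simp only <;> omega
  calc S.card ≤ _ := Finset.card_le_card hsub
    _ ≤ _ := Finset.card_image_le
    _ = _ := Finset.card_product _ _
    _ ≤ 2 * 2 := Nat.mul_le_mul Finset.card_le_two Finset.card_le_two

lemma card_le_four_mul {P : Set Plane} {k : ℤ} {S S' : Finset Plane}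
    (hS : (S : Set Plane) = diagonalGrid k ∩ P) (hS' : Covers P 1 (S' : Set Plane)) :
    S.card ≤ 4 * S'.card := by
  classical
  have hmem : ∀ q ∈ S, q ∈ diagonalGrid k ∩ P := fun q hq => hS ▸ Finset.mem_coe.2 hq
  choose! f hf using hS'
  refine Finset.card_le_mul_card_image_of_maps_to (f := f)
    (fun q hq => (hf q (hmem q hq).2).1) 4 fun p _ =>
    card_le_four_of_dist_le_one (k := k) (p := p) fun q hq => ?_
  obtain ⟨hqS, rfl⟩ := Finset.mem_filter.1 hq
  exact ⟨(hmem q hqS).1, (hf q (hmem q hqS).2).2.2⟩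

namespace Polyomino

variable (P : Polyomino)

/-- A solution whose scan points are the points of a diagonal grid, and whose tour goes once around
a tree of cells. -/
lemma exists_solution (k : ℤ) {z v : ℤ × ℤ} (hz : z ∈ P.cells) (hv : IsPixelCorner z v) :
    ∃ T : Solution P.region 1, T.start = gridPoint v ∧
      (T.scans : Set Plane) = diagonalGrid k ∩ P.region ∧
      T.length ≤ 2 * (P.cells.card : ℝ≥0∞) + 2 := by
  obtain ⟨p, hp⟩ := P.exists_isAround hz hv
  have hsupp : ∀ q ∈ diagonalGrid k ∩ P.region, ∃ w ∈ p.support, gridPoint w = q := by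
    rintro q ⟨hq, hqP⟩
    obtain ⟨w, -, rfl⟩ := mem_diagonalGrid.1 hq
    obtain ⟨y, hy, hyw⟩ := gridPoint_mem_region.1 hqP
    exact ⟨w, hp.corner_mem y hy w hyw, rfl⟩
  have hfin : (diagonalGrid k ∩ P.region).Finite :=
    (p.support.finite_toSet.image gridPoint).subset hsupp
  refine ⟨⟨gridPoint v, walkPath p, ?_, hfin.toFinset, ?_, ?_⟩, rfl, ?_, ?_⟩
  · intro t
    refine range_walkPath_subset p (gridPoint_mem_region.2 ⟨z, hz, hv⟩) ?_ ⟨t, rfl⟩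
    intro x y hxy
    obtain ⟨w, hw, hwx, hwy⟩ := hp.edge_subset x y hxy
    exact segment_subset_region hw (gridPoint_mem_pixel.2 hwx) (gridPoint_mem_pixel.2 hwy)
  · intro q hq
    obtain ⟨w, hw, rfl⟩ := hsupp q (hfin.mem_toFinset.1 hq)
    exact gridPoint_mem_range_walkPath p w hw
  · rw [hfin.coe_toFinset]
    exact P.covers_diagonalGrid k
  · exact hfin.coe_toFinset
  · refine (l1Length_walkPath_le p).trans (le_of_eq ?_)
    rw [hp.length_eq]
    push_cast
    rfl

variable {P}

lemma approximation {k : ℤ} {T : Solution P.region 1}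
    (hscans : (T.scans : Set Plane) = diagonalGrid k ∩ P.region)
    (hlen : T.length ≤ 2 * (P.cells.card : ℝ≥0∞) + 2) (T' : Solution P.region 1) :
    T.scans.card ≤ 4 * T'.scans.card ∧ T.length ≤ 4 * T'.length + 8 ∧
      ∀ c : ℝ≥0, T.cost c ≤ 4 * T'.cost c + 8 := by
  have hcard := card_le_four_mul hscans T'.covers
  have hlength : T.length ≤ 4 * T'.length + 8 := by
    refine hlen.trans ?_
    calc 2 * (P.cells.card : ℝ≥0∞) + 2 ≤ 2 * (3 + 2 * T'.length) + 2 := by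
          gcongr
          exact card_cells_le T'
      _ = 4 * T'.length + 8 := by ring
  refine ⟨hcard, hlength, fun c => ?_⟩
  have hcard' : (T.scans.card : ℝ≥0∞) ≤ 4 * T'.scans.card := by exact_mod_cast hcard
  calc T.cost c ≤ c * (4 * T'.scans.card) + (4 * T'.length + 8) := by
        unfold Solution.cost
        gcongr
    _ = 4 * T'.cost c + 8 := by
        unfold Solution.cost
        ring

end Polyomino

theorem theorem3 (P : Polyomino) (k : ℤ) :
    (∃ T : Solution P.region 1,
      (T.scans : Set Plane) = diagonalGrid k ∩ P.region ∧
      ∀ T' : Solution P.region 1,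
        T.scans.card ≤ 4 * T'.scans.card ∧
        T.length ≤ 4 * T'.length + 8 ∧
        ∀ c : ℝ≥0, T.cost c ≤ 4 * T'.cost c + 8) ∧
    (∀ s ∈ gridPoints ∩ P.region, ∃ T : Solution P.region 1,
      T.start = s ∧
      (T.scans : Set Plane) = diagonalGrid k ∩ P.region ∧
      ∀ T' : Solution P.region 1, T'.start = s →
        T.scans.card ≤ 4 * T'.scans.card ∧
        T.length ≤ 4 * T'.length + 8 ∧
        ∀ c : ℝ≥0, T.cost c ≤ 4 * T'.cost c + 8) := by
  constructor
  · obtain ⟨z, hz⟩ := P.cells_nonempty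
    obtain ⟨T, -, hscans, hlen⟩ := P.exists_solution k hz (v := z) (by simp [IsPixelCorner])
    exact ⟨T, hscans, Polyomino.approximation hscans hlen⟩
  · rintro s ⟨⟨a, b, h0, h1⟩, hsP⟩
    obtain rfl : gridPoint (a, b) = s := by
      ext i
      fin_cases i
      · exact h0.symm
      · exact h1.symm
    obtain ⟨z, hz, hzs⟩ := Polyomino.gridPoint_mem_region.1 hsP
    obtain ⟨T, hstart, hscans, hlen⟩ := P.exists_solution k hz hzs
    exact ⟨T, hstart, hscans, fun T' _ => Polyomino.approximation hscans hlen T'⟩
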